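/- Let $n$ be a natural number. On $L^2(\mathbb{R}^n)=L^2(\mathbb{R}^n;\mathbb{C})$ let $(u|v)=\int_{\mathbb{R}^n}u\,\overline{v}\,dx$ (linear in the first, antilinear in the second variable) and let $\|\cdot\|$ be the associated norm. All derivatives are distributional. Put $$H^1(\mathbb{R}^n)=\{\varphi\in L^2:\partial_j\varphi\in L^2\ \text{for all } j\},\qquad H^2(\mathbb{R}^n)=\{\varphi\in L^2:\partial_j\partial_k\varphi\in L^2\ \text{for all } j,k\},$$ and $\|\nabla\varphi\|^2=\sum_{j=1}^n\|\partial_j\varphi\|^2$ for $\varphi\in H^1(\mathbb{R}^n)$. Let $$A=-i\,x\cdot\nabla-i\tfrac n2,\quad D(A)=\{\varphi\in H^1(\mathbb{R}^n):x\cdot\nabla\varphi\in L^2(\mathbb{R}^n)\},\qquad B=-\Delta,\quad D(B)=H^2(\mathbb{R}^n),$$ let $M=D(A)\cap D(B)$, and define the commutator as the form $$([A,B]\varphi|\psi)=(B\varphi|A\psi)-(A\varphi|B\psi),\qquad \varphi,\psi\in M.$$ (a) For every $\varphi\in C_0^\infty(\mathbb{R}^n;\mathbb{C})$ one has $\varphi\in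 M$, $B\varphi\in D(A)$, $A\varphi\in D(B)$ and $AB\varphi-BA\varphi=2iB\varphi$. (b) For every $\varphi\in M$ with $A\varphi\neq0$ and $B\varphi\neq0$, $$2\|\nabla\varphi\|^2=2(B\varphi|\varphi)=-i([A,B]\varphi|\varphi)=-2\,\mathrm{Im}(A\varphi|B\varphi)=\|A\varphi\|\,\|B\varphi\|\left(2-\left\|\frac{A\varphi}{\|A\varphi\|}+i\,\frac{B\varphi}{\|B\varphi\|}\right\|^2\right).$$ (c) For every $\varphi\in M$, $$\|\nabla\varphi\|^2\le\left\|x\cdot\nabla\varphi+\tfrac n2\varphi\right\|\,\|\Delta\varphi\|.$$ -/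

import Mathlib

open MeasureTheory TemperedDistribution
open scoped SchwartzMap LineDeriv Laplacian ContDiff

noncomputable section

namespace DilationUncertainty

/-- The Euclidean space `ℝⁿ`. -/
abbrev Rn (n : ℕ) : Type := EuclideanSpace ℝ (Fin n)

/-- The Hilbert space `L²(ℝⁿ; ℂ)`. -/
abbrev L2 (n : ℕ) : Type := Lp ℂ 2 (volume : Measure (Rn n))

/-- The scalar product `(u|v) = ∫ u v̄ dx`, linear in the first and antilinear in the second
variable (Mathlib's `inner` is antilinear in the first one). -/
def sprod {n : ℕ} (u v : L2 n) : ℂ := inner ℂ v u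

/-- The embedding of `L²(ℝⁿ)` into the tempered distributions, `f ↦ (u ↦ ∫ u f dx)`. -/
def emb (n : ℕ) : L2 n →ₗ[ℂ] 𝓢'(Rn n, ℂ) :=
  (Lp.toTemperedDistributionCLM ℂ (volume : Measure (Rn n)) 2).toLinearMap

theorem emb_injective (n : ℕ) : Function.Injective (emb n) :=
  LinearMap.ker_eq_bot.mp
    (Lp.ker_toTemperedDistributionCLM_eq_bot (F := ℂ) (μ := (volume : Measure (Rn n))) (p := 2))

/-- The maximal realization in `L²(ℝⁿ)` of a linear operator `T` on tempered distributions: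
its domain is `{φ ∈ L² ; T φ ∈ L²}`, and there it maps `φ` to the `L²` function `T φ`. -/
def realization {n : ℕ} (T : 𝓢'(Rn n, ℂ) →L[ℂ] 𝓢'(Rn n, ℂ)) : L2 n →ₗ.[ℂ] L2 n where
  domain := (LinearMap.range (emb n)).comap (T.toLinearMap ∘ₗ emb n)
  toFun := (LinearEquiv.ofInjective (emb n) (emb_injective n)).symm.toLinearMap ∘ₗ
    (T.toLinearMap ∘ₗ emb n).restrict (fun _ h => h)

theorem emb_realization {n : ℕ} (T : 𝓢'(Rn n, ℂ) →L[ℂ] 𝓢'(Rn n, ℂ))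
    (φ : (realization T).domain) : emb n (realization T φ) = T (emb n (φ : L2 n)) :=
  congrArg Subtype.val ((LinearEquiv.ofInjective (emb n) (emb_injective n)).apply_symm_apply
    ((T.toLinearMap ∘ₗ emb n).restrict
      (p := (realization T).domain) (q := LinearMap.range (emb n)) (fun _ h => h) φ))

/-- The `j`-th standard basis vector of `ℝⁿ`. -/
def e {n : ℕ} (j : Fin n) : Rn n := EuclideanSpace.single j 1

/-- The distributional partial derivative `∂ⱼ`. -/
def partialDist {n : ℕ} (j : Fin n) : 𝓢'(Rn n, ℂ) →L[ℂ] 𝓢'(Rn n, ℂ) :=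
  LineDeriv.lineDerivOpCLM ℂ 𝓢'(Rn n, ℂ) (e j)

/-- The partial derivative `∂ⱼ` in `L²(ℝⁿ)`, with domain `{φ ∈ L² ; ∂ⱼφ ∈ L²}`. -/
def partialL2 {n : ℕ} (j : Fin n) : L2 n →ₗ.[ℂ] L2 n := realization (partialDist j)

/-- `H¹(ℝⁿ) = {φ ∈ L² ; ∂ⱼφ ∈ L² for all j}`. -/
def H1 (n : ℕ) : Submodule ℂ (L2 n) := ⨅ j : Fin n, (partialL2 j).domain

/-- `H²(ℝⁿ) = {φ ∈ L² ; ∂ⱼ∂ₖφ ∈ L² for all j, k}`. -/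
def H2 (n : ℕ) : Submodule ℂ (L2 n) :=
  ⨅ (j : Fin n) (k : Fin n), (realization (partialDist j ∘L partialDist k)).domain

/-- The gradient `∇φ = (∂₁φ, …, ∂ₙφ)` of `φ ∈ H¹`, an element of the Hilbert direct sum
`L²(ℝⁿ; ℂⁿ) = L²(ℝⁿ) ⊕ ⋯ ⊕ L²(ℝⁿ)`, so that `‖∇φ‖² = ∑ⱼ ‖∂ⱼφ‖²`. -/
def grad {n : ℕ} (φ : H1 n) : PiLp 2 (fun _ : Fin n => L2 n) :=
  WithLp.toLp 2 fun j => partialL2 j ⟨φ, (Submodule.mem_iInf _).mp φ.2 j⟩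

/-- The operator `x·∇ = ∑ⱼ xⱼ ∂ⱼ` on tempered distributions. -/
def xGradDist (n : ℕ) : 𝓢'(Rn n, ℂ) →L[ℂ] 𝓢'(Rn n, ℂ) :=
  ∑ j : Fin n, smulLeftCLM ℂ (fun x : Rn n => ((x j : ℝ) : ℂ)) ∘L partialDist j

/-- The operator `φ ↦ x·∇φ` in `L²(ℝⁿ)`, with domain `{φ ∈ H¹ ; x·∇φ ∈ L²}`. -/
def xGrad (n : ℕ) : L2 n →ₗ.[ℂ] L2 n where
  domain := H1 n ⊓ (realization (xGradDist n)).domain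
  toFun := (realization (xGradDist n)).toFun ∘ₗ Submodule.inclusion inf_le_right

/-- The generator of dilations `A = -i x·∇ - i n/2` with domain `{φ ∈ H¹ ; x·∇φ ∈ L²}`. -/
def opA (n : ℕ) : L2 n →ₗ.[ℂ] L2 n where
  domain := (xGrad n).domain
  toFun := (-Complex.I) • (xGrad n).toFun
    - (Complex.I * ((n : ℂ) / 2)) • (xGrad n).domain.subtype

theorem H2_le_domain_laplacian (n : ℕ) :
    H2 n ≤ (realization (LineDeriv.laplacianCLM ℂ (Rn n) 𝓢'(Rn n, ℂ))).domain := by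
  intro φ hφ
  have h : ∀ j : Fin n, partialDist j (partialDist j (emb n φ)) ∈ LinearMap.range (emb n) := by
    intro j
    exact (Submodule.mem_iInf _).mp ((Submodule.mem_iInf _).mp hφ j) j
  change LineDeriv.laplacianCLM ℂ (Rn n) 𝓢'(Rn n, ℂ) (emb n φ) ∈ LinearMap.range (emb n)
  rw [TemperedDistribution.laplacianCLM_apply,
    TemperedDistribution.laplacian_eq_sum (EuclideanSpace.basisFun (Fin n) ℝ)]
  refine Submodule.sum_mem _ fun j _ => ?_
  simpa [partialDist, e] using h j

/-- The Laplacian `Δ` in `L²(ℝⁿ)` with domain `H²(ℝⁿ)`. -/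
def lap (n : ℕ) : L2 n →ₗ.[ℂ] L2 n where
  domain := H2 n
  toFun := (realization (LineDeriv.laplacianCLM ℂ (Rn n) 𝓢'(Rn n, ℂ))).toFun ∘ₗ
    Submodule.inclusion (H2_le_domain_laplacian n)

/-- The free Hamiltonian `B = -Δ` with domain `H²(ℝⁿ)`. -/
def opB (n : ℕ) : L2 n →ₗ.[ℂ] L2 n where
  domain := (lap n).domain
  toFun := -(lap n).toFun

/-- The commutator of two operators as a sesquilinear form on `M = D(S) ∩ D(T)`:
`([S,T]φ|ψ) = (Tφ|Sψ) - (Sφ|Tψ)`. -/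
def commForm {n : ℕ} (S T : L2 n →ₗ.[ℂ] L2 n) (φ ψ : ↥(S.domain ⊓ T.domain)) : ℂ :=
  sprod (T ⟨φ, φ.2.2⟩) (S ⟨ψ, ψ.2.1⟩) - sprod (S ⟨φ, φ.2.1⟩) (T ⟨ψ, ψ.2.2⟩)

/-- `φ` is (the class of) a function in `C₀^∞(ℝⁿ; ℂ)`. -/
def IsTestFunction {n : ℕ} (φ : L2 n) : Prop :=
  ∃ f : Rn n → ℂ, ContDiff ℝ ∞ f ∧ HasCompactSupport f ∧ φ =ᵐ[volume] f

end DilationUncertainty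

end

/-! Part (a) is algebra of distributions: `[∂ₖ, x·∇] = ∂ₖ`, applied twice, gives `[Δ, x·∇] = 2Δ`;
the identity descends to `L²` because `emb` is injective. Schwartz classes lie in both domains and
are preserved by `A` and `B`, so all products exist.

On all of `M` the crux is the virial identity `2 Re (x·∇φ|Δφ) = (n - 2)‖∇φ‖²`
(`two_re_inner_lap_xGrad`). No density of test functions in `M` is used. The field `x` is instead
replaced by `x g(cx)`, with `g` real Schwartz and `g 0 = 1`; integration by parts is then
legitimate, and `c → 0` by dominated convergence. Together with `(Δφ|φ) = -‖∇φ‖²` this gives `Im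
(Aφ|Bφ) = (n - 2)/2 ‖∇φ‖² - n/2 ‖∇φ‖² = -‖∇φ‖²`. The rest of the chain is the expansion of the norm
of a sum of two unit vectors, and (c) is Cauchy–Schwarz. -/

noncomputable section

namespace DilationUncertainty

open Filter Topology

/-! ### Commuting derivatives and the product rule. -/

section Distributions

variable {E : Type*} [NormedAddCommGroup E] [NormedSpace ℝ E]

theorem schwartz_lineDerivOp_comm (v w : E) (f : 𝓢(E, ℂ)) : ∂_{v} (∂_{w} f) = ∂_{w} (∂_{v} f) := by
  ext x
  have key : ∀ a b : E, ∂_{a} (∂_{b} f) x = fderiv ℝ (fderiv ℝ f) x a b := by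
    intro a b
    have h2 : DifferentiableAt ℝ (fderiv ℝ f) x :=
      (((f.smooth ⊤).fderiv_right (m := 1) (by norm_cast)).differentiable (by norm_num)) x
    have h1 : ((∂_{b} f : 𝓢(E, ℂ)) : E → ℂ) = fun y => fderiv ℝ f y b := by
      ext y; rw [SchwartzMap.lineDerivOp_apply_eq_fderiv]
    rw [SchwartzMap.lineDerivOp_apply_eq_fderiv, h1, fderiv_clm_apply h2 (by fun_prop)]
    simp
  rw [key, key]
  exact ((f.smooth 2).contDiffAt.isSymmSndFDerivAt (by simp)) v w

theorem lineDerivOp_comm (v w : E) (T : 𝓢'(E, ℂ)) : ∂_{v} (∂_{w} T) = ∂_{w} (∂_{v} T) := by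
  ext u
  simp [schwartz_lineDerivOp_comm v w u]

/-- The product rule for Schwartz functions. -/
theorem schwartz_lineDerivOp_smulLeftCLM {g g' : E → ℂ} {v : E} (hg : g.HasTemperateGrowth)
    (hg' : g'.HasTemperateGrowth) (hd : ∀ x, fderiv ℝ g x v = g' x) (f : 𝓢(E, ℂ)) :
    ∂_{v} (SchwartzMap.smulLeftCLM ℂ g f)
      = SchwartzMap.smulLeftCLM ℂ g' f + SchwartzMap.smulLeftCLM ℂ g (∂_{v} f) := by
  ext x
  have hgd : DifferentiableAt ℝ g x := hg.1.differentiable (by norm_num) x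
  have h1 : (SchwartzMap.smulLeftCLM ℂ g f : E → ℂ) = fun y => g y * f y := by
    ext y; rw [SchwartzMap.smulLeftCLM_apply_apply hg, smul_eq_mul]
  rw [SchwartzMap.lineDerivOp_apply_eq_fderiv, h1, fderiv_fun_mul hgd f.differentiableAt]
  simp only [add_apply, SchwartzMap.smulLeftCLM_apply_apply hg,
    SchwartzMap.smulLeftCLM_apply_apply hg', SchwartzMap.lineDerivOp_apply_eq_fderiv,
    smul_apply, smul_eq_mul, hd]
  ring

/-- The product rule for tempered distributions. -/
theorem lineDerivOp_smulLeftCLM {g g' : E → ℂ} {v : E} (hg : g.HasTemperateGrowth)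
    (hg' : g'.HasTemperateGrowth) (hd : ∀ x, fderiv ℝ g x v = g' x) (T : 𝓢'(E, ℂ)) :
    ∂_{v} (smulLeftCLM ℂ g T) = smulLeftCLM ℂ g' T + smulLeftCLM ℂ g (∂_{v} T) := by
  ext u
  have h := schwartz_lineDerivOp_smulLeftCLM hg hg' hd u
  simp [h]

end Distributions

/-! ### Multiplication operators on `L²`. -/

section Multiplication

variable {n : ℕ}

theorem emb_apply (u : L2 n) (f : 𝓢(Rn n, ℂ)) : emb n u f = ∫ x, f x • u x := by
  simp [emb]

theorem emb_toLp (f : 𝓢(Rn n, ℂ)) :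
    emb n (f.toLp 2) = SchwartzMap.toTemperedDistributionCLM (Rn n) ℂ volume f :=
  Lp.toTemperedDistribution_toLp_eq f

/-- Both sides are locally integrable and agree against compactly supported smooth functions.
Unbounded `h` is allowed, as the Fourier symbol of `∂ⱼ` requires. -/
theorem ae_eq_mul_of_emb_eq_smulLeftCLM {h : Rn n → ℂ} (hh : h.HasTemperateGrowth) {u v : L2 n}
    (huv : emb n v = smulLeftCLM ℂ h (emb n u)) : v =ᵐ[volume] fun x => h x * u x := by
  refine ae_eq_of_integral_contDiff_smul_eq ((Lp.memLp v).locallyIntegrable (by norm_num)) ?_ ?_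
  · have hu := (Lp.memLp u).locallyIntegrable (by norm_num)
    have := (locallyIntegrableOn_univ.2 hu).continuousOn_mul hh.1.continuous.continuousOn
      isOpen_univ.isLocallyClosed
    exact locallyIntegrableOn_univ.1 this
  · intro g g_smooth g_cpt
    have hg₁ : HasCompactSupport (Complex.ofRealCLM ∘ g) := g_cpt.comp_left rfl
    have hg₂ : ContDiff ℝ ∞ (Complex.ofRealCLM ∘ g) := by fun_prop
    have := congrArg (fun T : 𝓢'(Rn n, ℂ) => T (hg₁.toSchwartzMap hg₂)) huv
    simp only [smulLeftCLM_apply_apply, emb_apply, SchwartzMap.smulLeftCLM_apply_apply hh] at this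
    simpa [mul_assoc, mul_comm, mul_left_comm] using this

/-- Multiplication of an `L²` function by a Schwartz function. -/
def mulL2 (g : 𝓢(Rn n, ℂ)) (u : L2 n) : L2 n :=
  ((g.memLp_top (volume : Measure (Rn n))).toLp g • u : L2 n)

theorem emb_mulL2 (g : 𝓢(Rn n, ℂ)) (u : L2 n) : emb n (mulL2 g u) = smulLeftCLM ℂ g (emb n u) :=
  Lp.toTemperedDistribution_smul_eq g.hasTemperateGrowth (g.memLp_top volume) u

theorem coeFn_mulL2 (g : 𝓢(Rn n, ℂ)) (u : L2 n) : mulL2 g u =ᵐ[volume] fun x => g x * u x :=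
  ae_eq_mul_of_emb_eq_smulLeftCLM g.hasTemperateGrowth (emb_mulL2 g u)

theorem inner_mulL2_of_real {g : 𝓢(Rn n, ℂ)} (hg : ∀ x, (starRingEnd ℂ) (g x) = g x) (u v : L2 n) :
    inner ℂ (mulL2 g u) v = inner ℂ u (mulL2 g v) := by
  rw [L2.inner_def, L2.inner_def]
  refine integral_congr_ae ?_
  filter_upwards [coeFn_mulL2 g u, coeFn_mulL2 g v] with x h1 h2
  simp [h1, h2, hg]
  ring

end Multiplication

/-! ### Integration by parts via Plancherel. -/

section IntegrationByParts

variable {n : ℕ}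

theorem partialDist_apply (j : Fin n) (T : 𝓢'(Rn n, ℂ)) : partialDist j T = ∂_{e j} T := rfl

theorem fourier_ae_eq_of_partialDist {j : Fin n} {u u' : L2 n}
    (hu : emb n u' = partialDist j (emb n u)) :
    (FourierTransform.fourier u' : L2 n) =ᵐ[volume]
      fun x => (2 * Real.pi * Complex.I * (inner ℝ x (e j) : ℝ)) *
        (FourierTransform.fourier u : L2 n) x := by
  refine ae_eq_mul_of_emb_eq_smulLeftCLM (by fun_prop) ?_
  have h1 : ∀ w : L2 n, emb n (FourierTransform.fourier w) = FourierTransform.fourier (emb n w) :=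
    fun w => (Lp.fourier_toTemperedDistribution_eq w).symm
  rw [h1, h1, hu, partialDist_apply, TemperedDistribution.fourier_lineDerivOp_eq]
  have ht : (fun x : Rn n => ((inner ℝ x (e j) : ℝ) : ℂ)).HasTemperateGrowth := by fun_prop
  rw [← smul_apply, ← smulLeftCLM_smul ht]
  rfl

/-- Integration by parts in `L²`. -/
theorem inner_partial_left {j : Fin n} {u u' v v' : L2 n}
    (hu : emb n u' = partialDist j (emb n u)) (hv : emb n v' = partialDist j (emb n v)) :
    inner ℂ u' v = -inner ℂ u v' := by
  -- On the Fourier side `∂ⱼ` is multiplication by a purely imaginary function; conjugating it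
  -- yields the sign.
  rw [← Lp.inner_fourier_eq u' v, ← Lp.inner_fourier_eq u v', L2.inner_def, L2.inner_def,
    ← integral_neg]
  refine integral_congr_ae ?_
  filter_upwards [fourier_ae_eq_of_partialDist hu, fourier_ae_eq_of_partialDist hv] with x h1 h2
  simp only [h1, h2, RCLike.inner_apply, map_mul, Complex.conj_ofReal, Complex.conj_I, map_ofNat]
  ring

end IntegrationByParts

/-! ### Commutators with `x·∇`. -/

section Coordinates

variable {n : ℕ}

theorem hasTemperateGrowth_coord (j : Fin n) :
    (fun x : Rn n => ((x j : ℝ) : ℂ)).HasTemperateGrowth :=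
  Function.HasTemperateGrowth.comp Function.Complex.hasTemperateGrowth_ofReal
    (EuclideanSpace.proj (𝕜 := ℝ) j : Rn n →L[ℝ] ℝ).hasTemperateGrowth

theorem fderiv_coord (j k : Fin n) (x : Rn n) :
    fderiv ℝ (fun x : Rn n => ((x j : ℝ) : ℂ)) x (e k) = if j = k then 1 else 0 := by
  have h : HasFDerivAt (fun x : Rn n => ((x j : ℝ) : ℂ))
      (Complex.ofRealCLM ∘L (EuclideanSpace.proj (𝕜 := ℝ) j : Rn n →L[ℝ] ℝ)) x :=
    (Complex.ofRealCLM ∘L (EuclideanSpace.proj (𝕜 := ℝ) j : Rn n →L[ℝ] ℝ)).hasFDerivAt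
  rw [h.fderiv]
  simp [e]
  split_ifs <;> simp

theorem partialDist_comm (j k : Fin n) (T : 𝓢'(Rn n, ℂ)) :
    partialDist j (partialDist k T) = partialDist k (partialDist j T) :=
  lineDerivOp_comm _ _ T

theorem partialDist_coord_smul (j k : Fin n) (T : 𝓢'(Rn n, ℂ)) :
    partialDist k (smulLeftCLM ℂ (fun x : Rn n => ((x j : ℝ) : ℂ)) T)
      = (if j = k then T else 0)
        + smulLeftCLM ℂ (fun x : Rn n => ((x j : ℝ) : ℂ)) (partialDist k T) := by
  have h := lineDerivOp_smulLeftCLM (v := e k) (hasTemperateGrowth_coord j)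
    (.const (if j = k then 1 else 0)) (fderiv_coord j k) T
  rw [partialDist_apply, partialDist_apply, h, smulLeftCLM_const]
  split_ifs
  · rw [one_smul]
  · exact congrArg (· + _) (zero_smul ℂ T)

theorem xGradDist_apply (T : 𝓢'(Rn n, ℂ)) :
    xGradDist n T
      = ∑ j, smulLeftCLM ℂ (fun x : Rn n => ((x j : ℝ) : ℂ)) (partialDist j T) := by
  simp [xGradDist]

theorem partialDist_xGradDist (k : Fin n) (T : 𝓢'(Rn n, ℂ)) :
    partialDist k (xGradDist n T) = partialDist k T + xGradDist n (partialDist k T) := by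
  simp only [xGradDist_apply, map_sum, partialDist_coord_smul, Finset.sum_add_distrib,
    partialDist_comm k]
  simp

theorem laplacianCLM_eq_sum_partialDist (T : 𝓢'(Rn n, ℂ)) :
    LineDeriv.laplacianCLM ℂ (Rn n) 𝓢'(Rn n, ℂ) T = ∑ k, partialDist k (partialDist k T) := by
  rw [TemperedDistribution.laplacianCLM_apply,
    TemperedDistribution.laplacian_eq_sum (EuclideanSpace.basisFun (Fin n) ℝ)]
  simp [partialDist, e]

/-- The commutator `[Δ, x·∇] = 2Δ` on tempered distributions. -/
theorem laplacian_xGradDist (T : 𝓢'(Rn n, ℂ)) :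
    LineDeriv.laplacianCLM ℂ (Rn n) 𝓢'(Rn n, ℂ) (xGradDist n T)
      = (2 : ℂ) • LineDeriv.laplacianCLM ℂ (Rn n) 𝓢'(Rn n, ℂ) T
        + xGradDist n (LineDeriv.laplacianCLM ℂ (Rn n) 𝓢'(Rn n, ℂ) T) := by
  simp only [laplacianCLM_eq_sum_partialDist, partialDist_xGradDist, map_add, map_sum,
    Finset.sum_add_distrib]
  module

end Coordinates

/-! ### From operators in `L²` to distributions. -/

section Realization

variable {n : ℕ}

theorem mem_domain_realization {T : 𝓢'(Rn n, ℂ) →L[ℂ] 𝓢'(Rn n, ℂ)} {u v : L2 n}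
    (h : emb n v = T (emb n u)) : u ∈ (realization T).domain :=
  ⟨v, h⟩

theorem emb_xGrad (u : (xGrad n).domain) : emb n (xGrad n u) = xGradDist n (emb n u) :=
  emb_realization (xGradDist n) ⟨u, u.2.2⟩

theorem emb_lap (u : (lap n).domain) :
    emb n (lap n u) = LineDeriv.laplacianCLM ℂ (Rn n) 𝓢'(Rn n, ℂ) (emb n u) :=
  emb_realization (LineDeriv.laplacianCLM ℂ (Rn n) 𝓢'(Rn n, ℂ))
    ⟨u, H2_le_domain_laplacian n u.2⟩

theorem opA_apply (u : L2 n) (hu : u ∈ (opA n).domain) :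
    opA n ⟨u, hu⟩ = (-Complex.I) • (xGrad n ⟨u, hu⟩ + ((n : ℂ) / 2) • u) := by
  change (-Complex.I) • xGrad n ⟨u, hu⟩ - (Complex.I * ((n : ℂ) / 2)) • u = _
  module

theorem opB_apply (u : L2 n) (hu : u ∈ (opB n).domain) :
    opB n ⟨u, hu⟩ = -lap n ⟨u, hu⟩ := rfl

theorem emb_opA (u : L2 n) (hu : u ∈ (opA n).domain) :
    emb n (opA n ⟨u, hu⟩)
      = (-Complex.I) • (xGradDist n (emb n u) + ((n : ℂ) / 2) • emb n u) := by
  rw [opA_apply, map_smul, map_add, map_smul, emb_xGrad]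

theorem emb_opB (u : L2 n) (hu : u ∈ (opB n).domain) :
    emb n (opB n ⟨u, hu⟩) = -LineDeriv.laplacianCLM ℂ (Rn n) 𝓢'(Rn n, ℂ) (emb n u) := by
  rw [opB_apply, map_neg, emb_lap]

end Realization

/-! ### The commutation relation on test functions. -/

section TestFunctions

variable {n : ℕ}

theorem partialDist_toLp (j : Fin n) (f : 𝓢(Rn n, ℂ)) :
    partialDist j (emb n (f.toLp 2)) = emb n ((∂_{e j} f : 𝓢(Rn n, ℂ)).toLp 2) := by
  rw [emb_toLp, emb_toLp, partialDist_apply, lineDerivOp_toTemperedDistributionCLM_eq]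

theorem smulLeftCLM_toLp {g : Rn n → ℂ} (hg : g.HasTemperateGrowth) (f : 𝓢(Rn n, ℂ)) :
    smulLeftCLM ℂ g (emb n (f.toLp 2)) = emb n ((SchwartzMap.smulLeftCLM ℂ g f).toLp 2) := by
  ext u
  rw [emb_toLp, emb_toLp]
  simp [SchwartzMap.smulLeftCLM_apply_apply hg, mul_assoc, mul_left_comm]

theorem exists_xGradDist_toLp (f : 𝓢(Rn n, ℂ)) :
    ∃ h : 𝓢(Rn n, ℂ), emb n (h.toLp 2) = xGradDist n (emb n (f.toLp 2)) := by
  refine ⟨∑ j, SchwartzMap.smulLeftCLM ℂ (fun x : Rn n => ((x j : ℝ) : ℂ)) (∂_{e j} f), ?_⟩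
  simp only [xGradDist_apply, partialDist_toLp, smulLeftCLM_toLp (hasTemperateGrowth_coord _)]
  simp only [emb_toLp, map_sum]

theorem toLp_mem_domain_opA (f : 𝓢(Rn n, ℂ)) : (f.toLp 2 : L2 n) ∈ (opA n).domain := by
  refine ⟨(Submodule.mem_iInf _).2 fun j => mem_domain_realization (partialDist_toLp j f).symm, ?_⟩
  obtain ⟨h, hh⟩ := exists_xGradDist_toLp f
  exact mem_domain_realization hh

theorem toLp_mem_domain_opB (f : 𝓢(Rn n, ℂ)) : (f.toLp 2 : L2 n) ∈ (opB n).domain := by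
  refine (Submodule.mem_iInf _).2 fun j => (Submodule.mem_iInf _).2 fun k =>
    mem_domain_realization (v := (∂_{e j} (∂_{e k} f) : 𝓢(Rn n, ℂ)).toLp 2) ?_
  simp [partialDist_toLp]

theorem opA_toLp (f : 𝓢(Rn n, ℂ)) :
    ∃ h : 𝓢(Rn n, ℂ), opA n ⟨f.toLp 2, toLp_mem_domain_opA f⟩ = h.toLp 2 := by
  obtain ⟨h, hh⟩ := exists_xGradDist_toLp f
  refine ⟨(-Complex.I) • (h + ((n : ℂ) / 2) • f), emb_injective n ?_⟩
  rw [emb_opA, ← hh]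
  simp only [emb_toLp, map_smul, map_add]

theorem opB_toLp (f : 𝓢(Rn n, ℂ)) :
    ∃ h : 𝓢(Rn n, ℂ), opB n ⟨f.toLp 2, toLp_mem_domain_opB f⟩ = h.toLp 2 := by
  refine ⟨-Δ f, emb_injective n ?_⟩
  rw [emb_opB, TemperedDistribution.laplacianCLM_apply]
  simp only [emb_toLp, map_neg]
  rw [laplacian_toTemperedDistributionCLM_eq]

theorem IsTestFunction.exists_toLp {φ : L2 n} (hφ : IsTestFunction φ) :
    ∃ f : 𝓢(Rn n, ℂ), φ = f.toLp 2 := by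
  obtain ⟨f, hf, hc, h⟩ := hφ
  refine ⟨hc.toSchwartzMap hf, Lp.ext (h.trans ?_)⟩
  exact ((hc.toSchwartzMap hf).coeFn_toLp 2 volume).symm

/-- The commutation relation `[A, B] = 2iB`, wherever both products are defined. -/
theorem opA_opB_sub_opB_opA {φ : L2 n} (hA : φ ∈ (opA n).domain) (hB : φ ∈ (opB n).domain)
    (hAB : opB n ⟨φ, hB⟩ ∈ (opA n).domain) (hBA : opA n ⟨φ, hA⟩ ∈ (opB n).domain) :
    opA n ⟨opB n ⟨φ, hB⟩, hAB⟩ - opB n ⟨opA n ⟨φ, hA⟩, hBA⟩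
      = (2 * Complex.I) • opB n ⟨φ, hB⟩ := by
  apply emb_injective n
  rw [map_sub, map_smul, emb_opA, emb_opB, emb_opB, emb_opA]
  simp only [map_smul, map_add, map_neg, laplacian_xGradDist]
  module

end TestFunctions

/-! ### Dilated cutoffs and their limits. -/

section Cutoff

variable {n : ℕ}

/-- The dilated Schwartz function `x ↦ f (c x)`. -/
def dilate (c : ℝ) (hc : c ≠ 0) (f : 𝓢(Rn n, ℂ)) : 𝓢(Rn n, ℂ) :=
  SchwartzMap.compCLMOfContinuousLinearEquiv ℂ
    (ContinuousLinearEquiv.smulLeft (R₁ := ℝ) (M₁ := Rn n) (Units.mk0 c hc)) f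

theorem dilate_apply (c : ℝ) (hc : c ≠ 0) (f : 𝓢(Rn n, ℂ)) (x : Rn n) :
    dilate c hc f x = f (c • x) := rfl

theorem lineDerivOp_dilate (c : ℝ) (hc : c ≠ 0) (f : 𝓢(Rn n, ℂ)) (v : Rn n) :
    ∂_{v} (dilate c hc f) = (c : ℂ) • dilate c hc (∂_{v} f) := by
  have h : ∂_{v} (dilate c hc f) = dilate c hc (∂_{c • v} f) :=
    SchwartzMap.lineDerivOp_compCLMOfContinuousLinearEquiv _ _ _ _
  rw [h, LineDeriv.lineDerivOp_left_smul]
  ext x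
  simp [dilate_apply]

theorem coord_smul_dilate (c : ℝ) (hc : c ≠ 0) (f : 𝓢(Rn n, ℂ)) (j : Fin n) :
    SchwartzMap.smulLeftCLM ℂ (fun x : Rn n => ((x j : ℝ) : ℂ)) (dilate c hc f)
      = (c : ℂ)⁻¹ •
        dilate c hc (SchwartzMap.smulLeftCLM ℂ (fun x : Rn n => ((x j : ℝ) : ℂ)) f) := by
  ext x
  have hc' : (c : ℂ) ≠ 0 := by exact_mod_cast hc
  simp only [SchwartzMap.smulLeftCLM_apply_apply (hasTemperateGrowth_coord j), dilate_apply,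
    smul_apply, smul_eq_mul, PiLp.smul_apply, Complex.ofReal_mul]
  field_simp

/-- The factor `c⁻¹` from the coordinate cancels the `c` of the chain rule. Derivatives of the
truncated field are thus dilates of a fixed Schwartz function, bounded uniformly in `c`. -/
theorem lineDerivOp_coord_smul_dilate (c : ℝ) (hc : c ≠ 0) (f : 𝓢(Rn n, ℂ)) (j : Fin n)
    (v : Rn n) :
    ∂_{v} (SchwartzMap.smulLeftCLM ℂ (fun x : Rn n => ((x j : ℝ) : ℂ)) (dilate c hc f))
      = dilate c hc
        (∂_{v} (SchwartzMap.smulLeftCLM ℂ (fun x : Rn n => ((x j : ℝ) : ℂ)) f)) := by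
  have hc' : (c : ℂ) ≠ 0 := by exact_mod_cast hc
  rw [coord_smul_dilate, LineDeriv.lineDerivOp_smul, lineDerivOp_dilate, smul_smul,
    inv_mul_cancel₀ hc', one_smul]

theorem lineDerivOp_coord_smul_apply_zero (f : 𝓢(Rn n, ℂ)) (j k : Fin n) :
    (∂_{e k} (SchwartzMap.smulLeftCLM ℂ (fun x : Rn n => ((x j : ℝ) : ℂ)) f) : 𝓢(Rn n, ℂ)) 0
      = if j = k then f 0 else 0 := by
  rw [schwartz_lineDerivOp_smulLeftCLM (hasTemperateGrowth_coord j)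
    (.const (if j = k then 1 else 0)) (fderiv_coord j k) f, add_apply,
    SchwartzMap.smulLeftCLM_apply_apply (.const _),
    SchwartzMap.smulLeftCLM_apply_apply (hasTemperateGrowth_coord j)]
  simp

variable (n) in
theorem exists_real_cutoff :
    ∃ g : 𝓢(Rn n, ℂ), (∀ x, (starRingEnd ℂ) (g x) = g x) ∧ g 0 = 1 := by
  let b : ContDiffBump (0 : Rn n) := ⟨1, 2, by norm_num, by norm_num⟩
  have h1 : HasCompactSupport (Complex.ofRealCLM ∘ b) := b.hasCompactSupport.comp_left rfl
  have h2 : ContDiff ℝ ∞ (Complex.ofRealCLM ∘ b) := Complex.ofRealCLM.contDiff.comp b.contDiff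
  refine ⟨h1.toSchwartzMap h2, fun x => Complex.conj_ofReal _, ?_⟩
  change ((b 0 : ℝ) : ℂ) = 1
  rw [b.one_of_mem_closedBall (by simp [b]), Complex.ofReal_one]

theorem tendsto_inner_mulL2_dilate (f : 𝓢(Rn n, ℂ)) (u v : L2 n) {c : ℕ → ℝ}
    (hc0 : ∀ m, c m ≠ 0) (hc : Tendsto c atTop (𝓝 0)) :
    Tendsto (fun m => inner ℂ u (mulL2 (dilate (c m) (hc0 m) f) v)) atTop
      (𝓝 (f 0 * inner ℂ u v)) := by
  have h1 : ∀ m, inner ℂ u (mulL2 (dilate (c m) (hc0 m) f) v)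
      = ∫ x, f (c m • x) * inner ℂ (u x) (v x) := by
    intro m
    rw [L2.inner_def]
    refine integral_congr_ae ?_
    filter_upwards [coeFn_mulL2 (dilate (c m) (hc0 m) f) v] with x hx
    simp only [hx, dilate_apply, RCLike.inner_apply]
    ring
  simp only [h1, L2.inner_def, ← integral_const_mul]
  obtain ⟨C, -, hC⟩ := f.decay 0 0
  have hC' : ∀ x, ‖f x‖ ≤ C := by simpa using hC
  have hint : Integrable (fun x => inner ℂ (u x) (v x)) := L2.integrable_inner u v
  refine tendsto_integral_of_dominated_convergence (fun x => C * ‖inner ℂ (u x) (v x)‖)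
    (fun m => ?_) (hint.norm.const_mul C) (fun m => .of_forall fun x => ?_)
    (.of_forall fun x => ?_)
  · exact (f.continuous.comp (continuous_const_smul (c m))).aestronglyMeasurable.mul
      hint.aestronglyMeasurable
  · rw [norm_mul]
    exact mul_le_mul_of_nonneg_right (hC' _) (norm_nonneg _)
  · have : Tendsto (fun m => c m • x) atTop (𝓝 (0 : Rn n)) := by
      simpa using hc.smul_const x
    exact ((f.continuous.tendsto 0).comp this).mul_const _

end Cutoff

/-! ### The virial identity. -/

section Virial

variable {n : ℕ}

theorem emb_partial_mulL2 {j : Fin n} (g : 𝓢(Rn n, ℂ)) {u u' : L2 n}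
    (hu : emb n u' = partialDist j (emb n u)) :
    emb n (mulL2 (∂_{e j} g) u + mulL2 g u') = partialDist j (emb n (mulL2 g u)) := by
  rw [map_add, emb_mulL2, emb_mulL2, emb_mulL2, hu, partialDist_apply, partialDist_apply,
    lineDerivOp_smulLeftCLM g.hasTemperateGrowth (∂_{e j} g : 𝓢(Rn n, ℂ)).hasTemperateGrowth
      fun x => (SchwartzMap.lineDerivOp_apply_eq_fderiv _ _ _).symm]

/-- Think of `P = ∇φ`, `Q = D²φ`. Moving `∂ₖ` off `Q k k` leaves a term with `a * Q k j`; by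
symmetry of `Q` it pairs with `P k` to half of `a ∂ⱼ|P k|²` in real part, and a second integration
by parts puts `∂ⱼ` on `a`. -/
theorem two_re_inner_mulL2 {P : Fin n → L2 n} {Q : Fin n → Fin n → L2 n}
    (hQ : ∀ j k, emb n (Q j k) = partialDist j (emb n (P k))) (hsymm : ∀ j k, Q j k = Q k j)
    {a : 𝓢(Rn n, ℂ)} (ha : ∀ x, (starRingEnd ℂ) (a x) = a x) (j k : Fin n) :
    2 * (inner ℂ (Q k k) (mulL2 a (P j))).re
      = (inner ℂ (P k) (mulL2 (∂_{e j} a) (P k))).re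
        - 2 * (inner ℂ (P k) (mulL2 (∂_{e k} a) (P j))).re := by
  have h1 := inner_partial_left (hQ k k) (emb_partial_mulL2 a (hQ k j))
  have h2 := inner_partial_left (hQ j k) (emb_partial_mulL2 a (hQ j k))
  rw [inner_add_right] at h1 h2
  rw [← inner_mulL2_of_real ha, ← inner_conj_symm] at h2
  have h1' := congrArg Complex.re h1
  have h2' := congrArg Complex.re h2
  simp only [Complex.neg_re, Complex.add_re, Complex.conj_re] at h1' h2'
  rw [hsymm k j] at h1'
  linarith

/-- Only the sum `X` is known to be in `L²`, not each `xⱼ P j`; absorbing `xⱼ` into the Schwartz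
factor makes every summand an `L²` function. -/
theorem mulL2_eq_sum {P : Fin n → L2 n} {X : L2 n}
    (hX : emb n X = ∑ j, smulLeftCLM ℂ (fun x : Rn n => ((x j : ℝ) : ℂ)) (emb n (P j)))
    (g : 𝓢(Rn n, ℂ)) :
    mulL2 g X = ∑ j, mulL2 (SchwartzMap.smulLeftCLM ℂ (fun x : Rn n => ((x j : ℝ) : ℂ)) g)
      (P j) := by
  apply emb_injective n
  rw [emb_mulL2, hX, map_sum, map_sum]
  refine Finset.sum_congr rfl fun j _ => ?_
  rw [emb_mulL2, smulLeftCLM_smulLeftCLM_apply (hasTemperateGrowth_coord j) g.hasTemperateGrowth]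
  congr 2
  ext x
  rw [SchwartzMap.smulLeftCLM_apply_apply (hasTemperateGrowth_coord j)]
  simp

/-- The virial identity `2 Re (x·∇φ|Δφ) = (n - 2) ‖∇φ‖²`. -/
theorem two_re_inner_lap_xGrad {P : Fin n → L2 n} {Q : Fin n → Fin n → L2 n}
    (hQ : ∀ j k, emb n (Q j k) = partialDist j (emb n (P k))) (hsymm : ∀ j k, Q j k = Q k j)
    {X : L2 n}
    (hX : emb n X = ∑ j, smulLeftCLM ℂ (fun x : Rn n => ((x j : ℝ) : ℂ)) (emb n (P j))) :
    2 * (inner ℂ (∑ k, Q k k) X).re = (n - 2) * ∑ k, ‖P k‖ ^ 2 := by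
  obtain ⟨g, hg, hg0⟩ := exists_real_cutoff n
  set A : Fin n → 𝓢(Rn n, ℂ) :=
    fun j => SchwartzMap.smulLeftCLM ℂ (fun x : Rn n => ((x j : ℝ) : ℂ)) g with hA
  set c : ℕ → ℝ := fun m => 1 / ((m : ℝ) + 1)
  have hc0 : ∀ m, c m ≠ 0 := fun m => by positivity
  have hc : Tendsto c atTop (𝓝 0) := tendsto_one_div_add_atTop_nhds_zero_nat
  have hre : ∀ (f : 𝓢(Rn n, ℂ)) (u v : L2 n),
      Tendsto (fun m => (inner ℂ u (mulL2 (dilate (c m) (hc0 m) f) v)).re) atTop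
        (𝓝 (f 0 * inner ℂ u v).re) := fun f u v =>
    (Complex.continuous_re.tendsto _).comp (tendsto_inner_mulL2_dilate f u v hc0 hc)
  have key : ∀ m, 2 * (inner ℂ (∑ k, Q k k) (mulL2 (dilate (c m) (hc0 m) g) X)).re
      = ∑ j, ∑ k, ((inner ℂ (P k) (mulL2 (dilate (c m) (hc0 m) (∂_{e j} (A j))) (P k))).re
        - 2 * (inner ℂ (P k) (mulL2 (dilate (c m) (hc0 m) (∂_{e k} (A j))) (P j))).re) := by
    intro m
    rw [mulL2_eq_sum hX, inner_sum, Complex.re_sum, Finset.mul_sum]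
    refine Finset.sum_congr rfl fun j _ => ?_
    rw [sum_inner, Complex.re_sum, Finset.mul_sum]
    refine Finset.sum_congr rfl fun k _ => ?_
    rw [two_re_inner_mulL2 hQ hsymm _ j k, lineDerivOp_coord_smul_dilate,
      lineDerivOp_coord_smul_dilate]
    intro x
    rw [SchwartzMap.smulLeftCLM_apply_apply (hasTemperateGrowth_coord j), dilate_apply]
    simp [hg]
  have lim1 := (hre g (∑ k, Q k k) X).const_mul 2
  simp only [key] at lim1
  have lim2 := tendsto_finsetSum Finset.univ fun j _ => tendsto_finsetSum Finset.univ fun k _ =>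
    (hre (∂_{e j} (A j)) (P k) (P k)).sub ((hre (∂_{e k} (A j)) (P k) (P j)).const_mul 2)
  have h := tendsto_nhds_unique lim1 lim2
  have hn : ∀ k, (inner ℂ (P k) (P k)).re = ‖P k‖ ^ 2 := fun k =>
    (inner_self_eq_norm_sq (𝕜 := ℂ) (P k))
  rw [hg0, one_mul] at h
  rw [h]
  -- At the origin `∂ₖ(xⱼ g)` is `δⱼₖ`: the divergence terms give `n ∑ ‖P k‖²`, the others `2 ∑ ‖P
  -- j‖²`.
  simp only [hA, lineDerivOp_coord_smul_apply_zero, hg0, if_true, one_mul, hn,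
    Finset.sum_sub_distrib]
  have hs : ∀ j : Fin n, ∑ k, 2 * ((if j = k then (1 : ℂ) else 0) * inner ℂ (P k) (P j)).re
      = 2 * ‖P j‖ ^ 2 := by
    intro j
    rw [Finset.sum_eq_single j]
    · rw [if_pos rfl, one_mul, hn]
    · intro k _ hk
      simp [hk.symm]
    · simp
  simp only [hs, ← Finset.mul_sum, Finset.sum_const, Finset.card_univ, Fintype.card_fin,
    nsmul_eq_mul]
  ring

end Virial

/-! ### The identities on `M`. -/

section Main

variable {n : ℕ}

theorem mem_domain_partialL2 {φ : L2 n} (h : φ ∈ H1 n) (j : Fin n) :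
    φ ∈ (partialL2 j).domain :=
  (Submodule.mem_iInf _).mp h j

theorem norm_grad_sq {φ : L2 n} (h : φ ∈ H1 n) :
    ‖grad ⟨φ, h⟩‖ ^ 2 = ∑ j, ‖partialL2 j ⟨φ, mem_domain_partialL2 h j⟩‖ ^ 2 :=
  PiLp.norm_sq_eq_of_L2 (fun _ : Fin n => L2 n) (grad ⟨φ, h⟩)

theorem inner_lap_left {φ : L2 n} (h1 : φ ∈ H1 n) (hB : φ ∈ (lap n).domain) :
    inner ℂ (lap n ⟨φ, hB⟩) φ = -((‖grad ⟨φ, h1⟩‖ ^ 2 : ℝ) : ℂ) ∧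
    ∀ hA : φ ∈ (xGrad n).domain,
      2 * (inner ℂ (lap n ⟨φ, hB⟩) (xGrad n ⟨φ, hA⟩)).re = (n - 2) * ‖grad ⟨φ, h1⟩‖ ^ 2 := by
  have hj := mem_domain_partialL2 h1
  have hjk : ∀ j k, φ ∈ (realization (partialDist j ∘L partialDist k)).domain := fun j k =>
    (Submodule.mem_iInf _).mp ((Submodule.mem_iInf _).mp hB j) k
  set P : Fin n → L2 n := fun j => partialL2 j ⟨φ, hj j⟩ with hPdef
  set Q : Fin n → Fin n → L2 n := fun j k => realization _ ⟨φ, hjk j k⟩ with hQdef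
  have hP : ∀ j, emb n (P j) = partialDist j (emb n φ) := fun j => emb_realization _ ⟨φ, hj j⟩
  have hQ : ∀ j k, emb n (Q j k) = partialDist j (emb n (P k)) := fun j k => by
    rw [hP]; exact emb_realization _ ⟨φ, hjk j k⟩
  have hsymm : ∀ j k, Q j k = Q k j := fun j k => by
    apply emb_injective n
    rw [hQ, hQ, hP, hP, partialDist_comm]
  have hL : lap n ⟨φ, hB⟩ = ∑ k, Q k k := by
    apply emb_injective n
    simp only [emb_lap, laplacianCLM_eq_sum_partialDist, map_sum, hQ, hP]
  have hgrad : ‖grad ⟨φ, h1⟩‖ ^ 2 = ∑ k, ‖P k‖ ^ 2 := norm_grad_sq h1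
  refine ⟨?_, fun hA => ?_⟩
  · rw [hL, hgrad, sum_inner, Complex.ofReal_sum, ← Finset.sum_neg_distrib]
    refine Finset.sum_congr rfl fun k _ => ?_
    rw [inner_partial_left (hQ k k) (hP k), inner_self_eq_norm_sq_to_K]
    simp
  · rw [hL, hgrad]
    refine two_re_inner_lap_xGrad hQ hsymm ?_
    simp only [emb_xGrad, xGradDist_apply, hP]

theorem sprod_opB_self {φ : L2 n} (h1 : φ ∈ H1 n) (hB : φ ∈ (opB n).domain) :
    sprod (opB n ⟨φ, hB⟩) φ = ((‖grad ⟨φ, h1⟩‖ ^ 2 : ℝ) : ℂ) := by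
  rw [sprod, opB_apply, inner_neg_right, ← inner_conj_symm, (inner_lap_left h1 hB).1, map_neg,
    Complex.conj_ofReal, neg_neg]

theorem im_sprod_opA_opB {φ : L2 n} (hA : φ ∈ (opA n).domain) (hB : φ ∈ (opB n).domain) :
    (sprod (opA n ⟨φ, hA⟩) (opB n ⟨φ, hB⟩)).im = -‖grad ⟨φ, hA.1⟩‖ ^ 2 := by
  obtain ⟨h1, h2⟩ := inner_lap_left hA.1 hB
  have h2 := h2 hA
  rw [sprod, opA_apply, opB_apply, inner_neg_left, inner_smul_right, inner_add_right,
    inner_smul_right]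
  erw [h1]
  rw [neg_mul, neg_neg, Complex.I_mul_im, Complex.add_re, mul_neg, Complex.neg_re,
    Complex.re_mul_ofReal]
  have h3 : ((n : ℂ) / 2).re = (n : ℝ) / 2 := by
    rw [show ((n : ℂ) / 2) = (((n : ℝ) / 2 : ℝ) : ℂ) by push_cast; rfl, Complex.ofReal_re]
  rw [h3]
  linarith

theorem commForm_self {S T : L2 n →ₗ.[ℂ] L2 n} (φ : ↥(S.domain ⊓ T.domain)) :
    -Complex.I * commForm S T φ φ
      = ((-2 * (sprod (S ⟨φ, φ.2.1⟩) (T ⟨φ, φ.2.2⟩)).im : ℝ) : ℂ) := by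
  have h : sprod (T ⟨φ, φ.2.2⟩) (S ⟨φ, φ.2.1⟩)
      = (starRingEnd ℂ) (sprod (S ⟨φ, φ.2.1⟩) (T ⟨φ, φ.2.2⟩)) := (inner_conj_symm _ _).symm
  rw [commForm, h]
  apply Complex.ext <;> simp
  ring

/-- For unit vectors the squared norm of the sum is `2 + 2 Re`, and the factor `i` turns the real
part into an imaginary part. -/
theorem neg_two_im_inner_eq {H : Type*} [NormedAddCommGroup H] [InnerProductSpace ℂ H] {u v : H}
    (hu : u ≠ 0) (hv : v ≠ 0) :
    -2 * (inner ℂ v u).im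
      = ‖u‖ * ‖v‖ * (2 - ‖((‖u‖ : ℂ)⁻¹ • u) + Complex.I • ((‖v‖ : ℂ)⁻¹ • v)‖ ^ 2) := by
  have hu' : ‖u‖ ≠ 0 := norm_ne_zero_iff.2 hu
  have hv' : ‖v‖ ≠ 0 := norm_ne_zero_iff.2 hv
  have h1 : ‖((‖u‖ : ℂ)⁻¹ • u)‖ = 1 := by simp [norm_smul, hu']
  have h2 : ‖Complex.I • ((‖v‖ : ℂ)⁻¹ • v)‖ = 1 := by simp [norm_smul, hv']
  have h3 : (inner ℂ ((‖u‖ : ℂ)⁻¹ • u) (Complex.I • ((‖v‖ : ℂ)⁻¹ • v))).re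
      = ‖u‖⁻¹ * ‖v‖⁻¹ * (inner ℂ v u).im := by
    rw [inner_smul_left, inner_smul_right, inner_smul_right, ← inner_conj_symm u v,
      ← Complex.ofReal_inv, ← Complex.ofReal_inv, Complex.conj_ofReal, Complex.re_ofReal_mul,
      Complex.I_mul_re, Complex.im_ofReal_mul, Complex.conj_im]
    ring
  have h4 := norm_add_sq (𝕜 := ℂ) ((‖u‖ : ℂ)⁻¹ • u) (Complex.I • ((‖v‖ : ℂ)⁻¹ • v))
  rw [h4, h1, h2, RCLike.re_eq_complex_re, h3]
  field_simp
  ring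

end Main

end DilationUncertainty

end

open DilationUncertainty in
theorem theorem3p4 (n : ℕ) :
    -- `[A,B] = AB - BA = 2iB` on `C₀^∞`, which lies in `D(AB) ∩ D(BA)`
    (∀ φ : L2 n, IsTestFunction φ →
      ∃ (hA : φ ∈ (opA n).domain) (hB : φ ∈ (opB n).domain)
        (hAB : opB n ⟨φ, hB⟩ ∈ (opA n).domain) (hBA : opA n ⟨φ, hA⟩ ∈ (opB n).domain),
        opA n ⟨opB n ⟨φ, hB⟩, hAB⟩ - opB n ⟨opA n ⟨φ, hA⟩, hBA⟩
          = (2 * Complex.I) • opB n ⟨φ, hB⟩) ∧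
    ∀ (φ : L2 n) (hA : φ ∈ (opA n).domain) (hB : φ ∈ (opB n).domain),
      -- the chain of equalities, for `Aφ ≠ 0` and `Bφ ≠ 0`
      (opA n ⟨φ, hA⟩ ≠ 0 → opB n ⟨φ, hB⟩ ≠ 0 →
        (2 : ℂ) * ((‖grad ⟨φ, hA.1⟩‖ ^ 2 : ℝ) : ℂ) = 2 * sprod (opB n ⟨φ, hB⟩) φ ∧
        2 * sprod (opB n ⟨φ, hB⟩) φ
          = -Complex.I * commForm (opA n) (opB n) ⟨φ, hA, hB⟩ ⟨φ, hA, hB⟩ ∧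
        -Complex.I * commForm (opA n) (opB n) ⟨φ, hA, hB⟩ ⟨φ, hA, hB⟩
          = ((-2 * (sprod (opA n ⟨φ, hA⟩) (opB n ⟨φ, hB⟩)).im : ℝ) : ℂ) ∧
        -2 * (sprod (opA n ⟨φ, hA⟩) (opB n ⟨φ, hB⟩)).im
          = ‖opA n ⟨φ, hA⟩‖ * ‖opB n ⟨φ, hB⟩‖ *
            (2 - ‖((‖opA n ⟨φ, hA⟩‖ : ℂ)⁻¹ • opA n ⟨φ, hA⟩)
                + Complex.I • ((‖opB n ⟨φ, hB⟩‖ : ℂ)⁻¹ • opB n ⟨φ, hB⟩)‖ ^ 2)) ∧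
      -- the resulting inequality
      ‖grad ⟨φ, hA.1⟩‖ ^ 2 ≤ ‖xGrad n ⟨φ, hA⟩ + ((n : ℂ) / 2) • φ‖ * ‖lap n ⟨φ, hB⟩‖ := by
  refine ⟨fun φ hφ => ?_, fun φ hA hB => ⟨fun hA0 hB0 => ⟨?_, ?_, ?_, ?_⟩, ?_⟩⟩
  · obtain ⟨f, rfl⟩ := hφ.exists_toLp
    obtain ⟨a, ha⟩ := opA_toLp f
    obtain ⟨b, hb⟩ := opB_toLp f
    exact ⟨toLp_mem_domain_opA f, toLp_mem_domain_opB f, hb ▸ toLp_mem_domain_opA b,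
      ha ▸ toLp_mem_domain_opB a, opA_opB_sub_opB_opA _ _ _ _⟩
  · rw [sprod_opB_self hA.1]
  · rw [commForm_self, im_sprod_opA_opB, sprod_opB_self hA.1]
    push_cast
    ring
  · exact commForm_self _
  · exact neg_two_im_inner_eq hA0 hB0
  · have h1 : ‖opA n ⟨φ, hA⟩‖ = ‖xGrad n ⟨φ, hA⟩ + ((n : ℂ) / 2) • φ‖ := by
      rw [opA_apply, norm_smul, norm_neg, Complex.norm_I, one_mul]
    have h2 : ‖opB n ⟨φ, hB⟩‖ = ‖lap n ⟨φ, hB⟩‖ := by rw [opB_apply, norm_neg]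
    calc ‖grad ⟨φ, hA.1⟩‖ ^ 2 = -(sprod (opA n ⟨φ, hA⟩) (opB n ⟨φ, hB⟩)).im := by
          rw [im_sprod_opA_opB, neg_neg]
      _ ≤ ‖sprod (opA n ⟨φ, hA⟩) (opB n ⟨φ, hB⟩)‖ :=
          (neg_le_abs _).trans (Complex.abs_im_le_norm _)
      _ ≤ ‖opB n ⟨φ, hB⟩‖ * ‖opA n ⟨φ, hA⟩‖ := norm_inner_le_norm _ _
      _ = _ := by rw [h1, h2, mul_comm]
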